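/- **Setting.** All functions are real-valued and identified when they agree almost everywhere. $C_0(\mathbb R^d)$ is the Banach space of continuous functions vanishing at infinity (sup norm), and $\mathcal M(\mathbb R^d)=(C_0(\mathbb R^d))'$ is the space of finite signed Borel measures with the total-variation norm $\|w\|_{\mathcal M}=\sup_{\|\varphi\|_\infty\le 1}\langle w,\varphi\rangle$. For $n\in\mathbb N$ let $L_{\infty,n}(\mathbb R^d)=\{f:\operatorname{ess\,sup}_x |f(x)|(1+\|x\|)^{-n}<\infty\}$ and $L_{1,-n}(\mathbb R^d)=\{g:\int|g(x)|(1+\|x\|)^{n}\,dx<\infty\}$. *Operator.* Let $n_0\in\mathbb N$. The operator $\mathrm L$ acts on $L_{\infty,n_0}(\mathbb R^d)$ in the weak sense: there is a space $\mathcal T$ of test functions, dense in $C_0(\mathbb R^d)$ (for instance the Schwartz space $\mathcal S(\mathbb R^d)$), and a linear map $\mathrm L^*:\mathcal T\to L_{1,-n_0}(\mathbb R^d)$, and $\langle \mathrm Lf,\varphi\rangle=\int f\,\mathrm L^*\varphi\,dx$ for $\varphi\in\mathcal T$. The native space is $\mathcal M_{\mathrm L}(\mathbb R^d)=\{f\in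 L_{\infty,n_0}(\mathbb R^d):\mathrm Lf\in\mathcal M(\mathbb R^d)\}$ and the null space is $\mathcal N_{\mathrm L}=\{q\in L_{\infty,n_0}(\mathbb R^d):\mathrm Lq=0\}$. $\mathrm L$ is *spline-admissible* with Green's function $\rho_{\mathrm L}$ if $\mathcal S(\mathbb R^d)\subset\mathcal M_{\mathrm L}(\mathbb R^d)$; $\mathrm L:\mathcal M_{\mathrm L}(\mathbb R^d)\to\mathcal M(\mathbb R^d)$ is shift-invariant; $\rho_{\mathrm L}$ is a function of slow growth with $n_0=\min\{n\in\mathbb N:\rho_{\mathrm L}\in L_{\infty,n}(\mathbb R^d)\}$ and $\mathrm L\rho_{\mathrm L}=\delta$; and $N_0=\dim\mathcal N_{\mathrm L}<\infty$. *Weak\* topology.* Fix a basis $p_1,\dots,p_{N_0}$ of $\mathcal N_{\mathrm L}$ and linear functionals $\phi_1,\dots,\phi_{N_0}$ on $\mathcal M_{\mathrm L}(\mathbb R^d)$ with $\langle\phi_m,p_n\rangle=\delta_{mn}$. The predual $C_{\mathrm L}(\mathbb R^d)=\mathrm L^*(C_0(\mathbb R^d))+\operatorname{span}\{\phi_n\}$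 is the space of the functionals $f\mapsto\langle\mathrm Lf,h\rangle+\sum_n c_n\langle\phi_n,f\rangle$ with $h\in C_0(\mathbb R^d)$, $c\in\mathbb R^{N_0}$. The weak\* topology of $\mathcal M_{\mathrm L}(\mathbb R^d)$ is the coarsest one for which all elements of $C_{\mathrm L}(\mathbb R^d)$ are continuous. **Theorem 1 (gTV optimality of splines for linear inverse problems).** Assume that 1. $\mathrm L$ is spline-admissible with Green's function $\rho_{\mathrm L}$; 2. $\nu:\mathcal M_{\mathrm L}(\mathbb R^d)\to\mathbb R^M$ is linear and weak\*-continuous; 3. $\nu(q_1)=\nu(q_2)\Leftrightarrow q_1=q_2$ for all $q_1,q_2\in\mathcal N_{\mathrm L}$. Let $\mathcal C\subset\mathbb R^M$ be convex and compact and such that $\nu(f)\in\mathcal C$ for some $f\in\mathcal M_{\mathrm L}(\mathbb R^d)$. Then the minimum $$\beta=\min_{f\in\mathcal M_{\mathrm L}(\mathbb R^d)}\|\mathrm Lf\|_{\mathcal M}\quad\text{s.t.}\quad\nu(f)\in\mathcal C$$ is attained, and every extreme point $s$ of the set of minimizers is a nonuniform $\mathrm L$-spline $$s(x)=\sum_{k=1}^K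 a_k\,\rho_{\mathrm L}(x-x_k)+\sum_{n=1}^{N_0}b_n\,p_n(x)\quad\text{for almost every }x,\qquad \mathrm Ls=\sum_{k=1}^K a_k\,\delta(\cdot-x_k),$$ with $K\le M$, distinct knots $x_k\in\mathbb R^d$, $a\in\mathbb R^K$, $b\in\mathbb R^{N_0}$, and $\beta=\|\mathrm Ls\|_{\mathcal M}=\sum_{k=1}^K|a_k|=\|a\|_1$. The set of all minimizers is the weak\*-closed convex hull of its extreme points. -/

import Mathlib

open MeasureTheory Set
open scoped ZeroAtInfty SchwartzMap

noncomputable section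

namespace GTV

/-- The domain `ℝᵈ`, with the Euclidean norm. -/
abbrev E (d : ℕ) : Type := EuclideanSpace ℝ (Fin d)

/-- Measurable real functions on `ℝᵈ`, up to equality almost everywhere. -/
abbrev Fun (d : ℕ) : Type := E d →ₘ[(volume : Measure (E d))] ℝ

/-- Finite signed Borel measures on `ℝᵈ`, as the Banach dual of `C₀(ℝᵈ)`. The operator norm
`‖w‖ = sup {⟨w, φ⟩ : ‖φ‖_∞ ≤ 1}` is the total variation norm. -/
abbrev M (d : ℕ) : Type := StrongDual ℝ C₀(E d, ℝ)

/-- The translate `f(· - y)` of a function. -/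
def shift {d : ℕ} (y : E d) (f : Fun d) : Fun d :=
  f.compMeasurePreserving (fun x => x - y) (measurePreserving_sub_right volume y)

/-- The translate `φ(· + y)` of a function vanishing at infinity. -/
def shiftC0 {d : ℕ} (y : E d) (φ : C₀(E d, ℝ)) : C₀(E d, ℝ) :=
  φ.comp (Homeomorph.addRight y : E d ≃ₜ E d).toCocompactMap

/-- The Dirac impulse `δ(· - y)`. -/
def dirac {d : ℕ} (y : E d) : M d :=
  LinearMap.mkContinuous
    { toFun := fun φ : C₀(E d, ℝ) => φ y
      map_add' := fun _ _ => rfl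
      map_smul' := fun _ _ => rfl } 1
    (fun φ => by
      rw [one_mul, ← ZeroAtInftyContinuousMap.norm_toBCF_eq_norm]
      exact φ.toBCF.norm_coe_le_norm y)

/-- `L_{∞,n}(ℝᵈ)`: the functions with `ess sup |f(x)| (1 + ‖x‖)^{-n} < ∞`. -/
def weightedLinf (d n : ℕ) : Submodule ℝ (Fun d) where
  carrier := {f | ∃ C : ℝ, ∀ᵐ x : E d, |f x| ≤ C * (1 + ‖x‖) ^ n}
  zero_mem' := ⟨0, by
    filter_upwards [AEEqFun.coeFn_zero (α := E d) (β := ℝ) (μ := volume)] with x hx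
    simp [hx]⟩
  add_mem' := by
    rintro f g ⟨A, hA⟩ ⟨B, hB⟩
    refine ⟨A + B, ?_⟩
    filter_upwards [hA, hB, AEEqFun.coeFn_add f g] with x h1 h2 h3
    rw [h3, Pi.add_apply, add_mul]
    exact (abs_add_le _ _).trans (add_le_add h1 h2)
  smul_mem' := by
    rintro c f ⟨A, hA⟩
    refine ⟨|c| * A, ?_⟩
    filter_upwards [hA, AEEqFun.coeFn_smul c f] with x h1 h2
    rw [h2, Pi.smul_apply, smul_eq_mul, abs_mul, mul_assoc]
    exact mul_le_mul_of_nonneg_left h1 (abs_nonneg c)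

/-- `L_{1,-n}(ℝᵈ)`: the functions with `∫ |g(x)| (1 + ‖x‖)^n dx < ∞`. -/
def weightedL1 (d n : ℕ) : Submodule ℝ (Fun d) where
  carrier := {g | Integrable (fun x : E d => g x * (1 + ‖x‖) ^ n)}
  zero_mem' := by
    refine (integrable_zero (E d) ℝ volume).congr ?_
    filter_upwards [AEEqFun.coeFn_zero (α := E d) (β := ℝ) (μ := volume)] with x hx
    simp [hx]
  add_mem' := by
    intro f g hf hg
    refine (Integrable.add hf hg).congr ?_
    filter_upwards [AEEqFun.coeFn_add f g] with x h3
    simp [h3, add_mul]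
  smul_mem' := by
    intro c f hf
    refine (Integrable.smul c hf).congr ?_
    filter_upwards [AEEqFun.coeFn_smul c f] with x h3
    simp [h3, mul_assoc]

/-- A product of a function in `L_{∞,n}` and one in `L_{1,-n}` is integrable. -/
theorem integrable_pair {d n : ℕ} {f g : Fun d} (hf : f ∈ weightedLinf d n)
    (hg : g ∈ weightedL1 d n) : Integrable (fun x : E d => f x * g x) := by
  obtain ⟨C, hC⟩ := hf
  have hg' : Integrable (fun x : E d => g x * (1 + ‖x‖) ^ n) := hg
  refine (hg'.const_mul C).mono (f.aestronglyMeasurable.mul g.aestronglyMeasurable) ?_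
  filter_upwards [hC] with x hx
  have h0 : (0 : ℝ) ≤ (1 + ‖x‖) ^ n := by positivity
  rw [Real.norm_eq_abs, Real.norm_eq_abs, abs_mul, abs_mul, abs_mul, abs_of_nonneg h0]
  calc |f x| * |g x| ≤ (C * (1 + ‖x‖) ^ n) * |g x| :=
        mul_le_mul_of_nonneg_right hx (abs_nonneg _)
    _ = C * (|g x| * (1 + ‖x‖) ^ n) := by ring
    _ ≤ |C| * (|g x| * (1 + ‖x‖) ^ n) :=
        mul_le_mul_of_nonneg_right (le_abs_self C) (by positivity)

/-- A linear operator `L` acting on `L_{∞,n}(ℝᵈ)` in the weak sense, given by its formal adjoint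
`L⋆ : 𝒯 → L_{1,-n}(ℝᵈ)` on a space `𝒯` of test functions that is dense in `C₀(ℝᵈ)`: `L f` is
`φ ↦ ⟨f, L⋆ φ⟩ = ∫ f (L⋆ φ)`. For differential operators `𝒯` is the Schwartz space; nonlocal
operators may need fewer test functions for `L⋆ φ` to decay fast enough. -/
structure Operator (d n : ℕ) where
  test : Submodule ℝ C₀(E d, ℝ)
  dense_test : Dense (test : Set C₀(E d, ℝ))
  adj : test →ₗ[ℝ] weightedL1 d n

namespace Operator

variable {d n : ℕ}

/-- `L f = w` in the weak sense, for a finite measure `w`. -/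
def Maps (L : Operator d n) (f : Fun d) (w : M d) : Prop :=
  ∀ φ : L.test, ∫ x, f x * (L.adj φ : Fun d) x = w (φ : C₀(E d, ℝ))

/-- `L f` is unique, since the test functions are dense in `C₀(ℝᵈ)`. -/
theorem Maps.unique {L : Operator d n} {f : Fun d} {w w' : M d}
    (h : L.Maps f w) (h' : L.Maps f w') : w = w' := by
  refine ContinuousLinearMap.ext fun φ => congrFun
    (Continuous.ext_on L.dense_test w.continuous w'.continuous ?_) φ
  intro φ hφ
  exact (h ⟨φ, hφ⟩).symm.trans (h' ⟨φ, hφ⟩)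

theorem Maps.zero (L : Operator d n) : L.Maps 0 0 := by
  intro φ
  refine (integral_eq_zero_of_ae ?_).trans rfl
  filter_upwards [AEEqFun.coeFn_zero (α := E d) (β := ℝ) (μ := volume)] with x hx
  simp [hx]

theorem Maps.add {L : Operator d n} {f g : Fun d} {v w : M d}
    (hf : f ∈ weightedLinf d n) (hg : g ∈ weightedLinf d n)
    (h : L.Maps f v) (h' : L.Maps g w) : L.Maps (f + g) (v + w) := by
  intro φ
  rw [add_apply, ← h φ, ← h' φ,
    ← integral_add (integrable_pair hf (L.adj φ).2) (integrable_pair hg (L.adj φ).2)]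
  refine integral_congr_ae ?_
  filter_upwards [AEEqFun.coeFn_add f g] with x hx
  rw [hx, Pi.add_apply, add_mul]

theorem Maps.smul {L : Operator d n} {f : Fun d} {w : M d} (c : ℝ)
    (h : L.Maps f w) : L.Maps (c • f) (c • w) := by
  intro φ
  rw [smul_apply, ← h φ, smul_eq_mul, ← integral_const_mul]
  refine integral_congr_ae ?_
  filter_upwards [AEEqFun.coeFn_smul c f] with x hx
  rw [hx, Pi.smul_apply, smul_eq_mul, mul_assoc]

/-- The native space `M_L(ℝᵈ) = {f ∈ L_{∞,n}(ℝᵈ) : L f ∈ M(ℝᵈ)}`. -/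
def nativeSpace (L : Operator d n) : Submodule ℝ (Fun d) where
  carrier := {f | f ∈ weightedLinf d n ∧ ∃ w : M d, L.Maps f w}
  zero_mem' := ⟨Submodule.zero_mem _, 0, Maps.zero L⟩
  add_mem' := by
    rintro f g ⟨hf, v, hv⟩ ⟨hg, w, hw⟩
    exact ⟨Submodule.add_mem _ hf hg, v + w, Maps.add hf hg hv hw⟩
  smul_mem' := by
    rintro c f ⟨hf, w, hw⟩
    exact ⟨Submodule.smul_mem _ c hf, c • w, hw.smul c⟩

/-- The operator `L : M_L(ℝᵈ) → M(ℝᵈ)`. -/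
def toFun (L : Operator d n) : L.nativeSpace →ₗ[ℝ] M d where
  toFun f := f.2.2.choose
  map_add' f g := Maps.unique (f + g).2.2.choose_spec
    (Maps.add f.2.1 g.2.1 f.2.2.choose_spec g.2.2.choose_spec)
  map_smul' c f := Maps.unique (c • f).2.2.choose_spec (Maps.smul c f.2.2.choose_spec)

/-- The null space `N_L = {q ∈ L_{∞,n}(ℝᵈ) : L q = 0}`, as a subspace of `M_L(ℝᵈ)`. -/
def nullSpace (L : Operator d n) : Submodule ℝ L.nativeSpace := LinearMap.ker L.toFun

/-- `L` is spline-admissible, with Green's function `ρ` whose rate of polynomial growth is `n`. -/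
structure SplineAdmissible (L : Operator d n) (ρ : Fun d) : Prop where
  /-- The native space contains the Schwartz functions. -/
  schwartz_mem : ∀ φ : 𝓢(E d, ℝ),
    AEEqFun.mk (φ : E d → ℝ) φ.continuous.aestronglyMeasurable ∈ L.nativeSpace
  /-- `L` is shift-invariant: `L {f(· - y)} = (L f)(· - y)`. -/
  shift_invariant : ∀ (f : L.nativeSpace) (y : E d), ∃ h : shift y f ∈ L.nativeSpace,
    ∀ φ : C₀(E d, ℝ), L.toFun ⟨shift y f, h⟩ φ = L.toFun f (shiftC0 y φ)
  /-- The rate of growth of `ρ` is `n`. -/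
  growth : IsLeast {m : ℕ | ρ ∈ weightedLinf d m} n
  /-- `L ρ = δ`. -/
  green : ∃ h : ρ ∈ L.nativeSpace, L.toFun ⟨ρ, h⟩ = dirac 0
  /-- The null space has finite dimension. -/
  finite_null : FiniteDimensional ℝ L.nullSpace

/-- `(φ, p)` is a biorthogonal system for the null space: `p` is a basis of `N_L` and
`⟨φ_m, p_k⟩ = δ_{mk}`. -/
def Biorthogonal (L : Operator d n) {N₀ : ℕ} (φ : Fin N₀ → Module.Dual ℝ L.nativeSpace)
    (p : Module.Basis (Fin N₀) ℝ L.nullSpace) : Prop :=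
  ∀ m k, φ m (p k : L.nativeSpace) = if m = k then 1 else 0

/-- The predual `C_L(ℝᵈ) = L⋆(C₀(ℝᵈ)) + span {φ_n}` of the native space, as a space of functionals
on `M_L(ℝᵈ)`. Here `L⋆ h` is the functional `f ↦ ⟨L f, h⟩`. -/
def predual (L : Operator d n) {N₀ : ℕ} (φ : Fin N₀ → Module.Dual ℝ L.nativeSpace) :
    Submodule ℝ (Module.Dual ℝ L.nativeSpace) :=
  Submodule.span ℝ
    ({ℓ | ∃ h : C₀(E d, ℝ), ∀ f : L.nativeSpace, ℓ f = L.toFun f h} ∪ range φ)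

/-- The weak* topology of `M_L(ℝᵈ) = (C_L(ℝᵈ))'`: the coarsest topology for which the elements of
`C_L(ℝᵈ)` are continuous on `M_L(ℝᵈ)`. -/
@[reducible] def weakStar (L : Operator d n) {N₀ : ℕ} (φ : Fin N₀ → Module.Dual ℝ L.nativeSpace) :
    TopologicalSpace L.nativeSpace :=
  TopologicalSpace.induced (fun f (ℓ : L.predual φ) => (ℓ : Module.Dual ℝ L.nativeSpace) f)
    Pi.topologicalSpace

/-- The set of minimizers of `‖L f‖_M` over the `f ∈ M_L(ℝᵈ)` with `ν(f) ∈ C`. -/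
def solutions (L : Operator d n) {m : ℕ} (ν : L.nativeSpace →ₗ[ℝ] (Fin m → ℝ))
    (C : Set (Fin m → ℝ)) : Set L.nativeSpace :=
  {f | ν f ∈ C ∧ ∀ g : L.nativeSpace, ν g ∈ C → ‖L.toFun f‖ ≤ ‖L.toFun g‖}

end Operator

end GTV

end

/-! The map `embed`, `f ↦ (L f, φ(f))`, carries the native space into `M × ℝ^N₀` with the weak*
topology on the first factor. It is injective and induces the weak* topology of the native space,
and `ν` extends continuously along it. Surjectivity of `L` onto `M` is not assumed, so compactness
may fail in the native space. In the extended space it holds: Banach–Alaoglu bounds the measure, and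
injectivity of `ν` on the null space bounds the coordinates. The extended minimizers thus form a
nonempty compact convex set, to which Krein–Milman applies.

An extreme minimizer is sparse by perturbation. Let `w` be its measure and suppose that the products
`g w`, with `g` compactly supported, are attained. Given `m + 1` such products, some nontrivial
combination `G w` is attained by an `H` with `ν H = 0`. For small `ε` the norms of `(1 + εG) w` and
`(1 - εG) w` add up to at most `2‖w‖`, so both perturbations are minimizers; extremality forces `G w
= 0`. Hence the support of `w` has at most `m` points.

In the extended space all products are attained. The extreme points there are Dirac combinations,
which shifted Green's functions lift to the native space; so both problems have the same minimum,
and Krein–Milman transfers. For extreme points of the native problem, `g w` must lie in the range of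
`L`: this is `exists_toFun_eq_mulMeasure`, where the Green's function bounds `φ(y)` by `L⋆ φ` and
duality solves the equation. -/

noncomputable section
namespace GTV

/-! ### Duality between weighted `L¹` and weighted `L^∞` -/

/-- The dual of `L¹` of a finite measure is `L^∞`. -/
theorem exists_bounded_repr_of_dual_L1 {α : Type*} [MeasurableSpace α] (μ : Measure α)
    [IsFiniteMeasure μ] (Λ : StrongDual ℝ (Lp ℝ 1 μ)) :
    ∃ f : α → ℝ, StronglyMeasurable f ∧ (∀ᵐ x ∂μ, |f x| ≤ ‖Λ‖) ∧
      ∀ h : Lp ℝ 1 μ, Λ h = ∫ x, f x * h x ∂μ := by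
  have hle : (1 : ENNReal) ≤ 2 := by norm_num
  -- As `μ` is finite, `L²` embeds boundedly in `L¹`; Riesz representation in `L²` then yields the
  -- density.
  let ι : Lp ℝ 2 μ →ₗ[ℝ] Lp ℝ 1 μ :=
    { toFun := fun h => ⟨h.1, Lp.antitone hle h.2⟩
      map_add' := fun _ _ => rfl
      map_smul' := fun _ _ => rfl }
  have hι : ∀ h, ‖ι h‖ ≤ ((μ univ) ^ (1 / 2 : ℝ)).toReal * ‖h‖ := by
    intro h
    have := eLpNorm_le_eLpNorm_mul_rpow_measure_univ hle (Lp.aestronglyMeasurable h)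
    rw [Lp.norm_def, Lp.norm_def, mul_comm, ← ENNReal.toReal_mul]
    refine ENNReal.toReal_mono (ENNReal.mul_ne_top (Lp.eLpNorm_ne_top h) ?_) ?_
    · exact ENNReal.rpow_ne_top_of_nonneg (by norm_num) (measure_ne_top _ _)
    · convert! this using 3
      norm_num
  let f := (InnerProductSpace.toDual ℝ (Lp ℝ 2 μ)).symm (Λ.comp (ι.mkContinuous _ hι))
  have hf : ∀ h : Lp ℝ 2 μ, Λ (ι h) = ∫ x, f x * h x ∂μ := by
    intro h
    have h1 : inner ℝ f h = Λ (ι h) := by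
      simp only [f, InnerProductSpace.toDual_symm_apply]; rfl
    rw [← h1, L2.inner_def]
    simp [mul_comm]
  have hfi : Integrable f μ := (Lp.memLp f).integrable hle
  have hind : ∀ (c : ℝ) (s : Set α) (hs : MeasurableSet s),
      Λ (indicatorConstLp 1 hs (measure_ne_top μ s) c) = ∫ x in s, f x * c ∂μ := by
    intro c s hs
    have h2 : ι (indicatorConstLp 2 hs (measure_ne_top μ s) c)
        = indicatorConstLp 1 hs (measure_ne_top μ s) c := rfl
    rw [← h2, hf, ← integral_indicator hs]
    refine integral_congr_ae ?_
    filter_upwards [indicatorConstLp_coeFn (p := 2) (hs := hs) (hμs := measure_ne_top μ s) (c := c)]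
      with x hx
    rw [hx]
    by_cases h : x ∈ s <;> simp [h]
  -- Testing on `c · 1_s` compares the integrals of `c f` and `‖Λ‖` over every set `s`; the signs `c
  -- = ±1` give the two-sided bound.
  have hbd : ∀ c : ℝ, |c| = 1 → ∀ᵐ x ∂μ, f x * c ≤ ‖Λ‖ := by
    intro c hc
    refine ae_le_of_forall_setIntegral_le (hfi.mul_const c) (integrable_const _) ?_
    intro s hs _
    rw [← hind c s hs]
    refine (le_abs_self _).trans ((Λ.le_opNorm _).trans ?_)
    rw [norm_indicatorConstLp one_ne_zero ENNReal.one_ne_top, Real.norm_eq_abs, hc]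
    simp [mul_comm, Measure.real]
  refine ⟨f, Lp.stronglyMeasurable f, ?_, ?_⟩
  · filter_upwards [hbd 1 (by simp), hbd (-1) (by simp)] with x h1 h2
    rw [abs_le]
    constructor <;> linarith
  · have hae : ∀ᵐ x ∂μ, ‖f x‖ ≤ ‖Λ‖ := by
      filter_upwards [hbd 1 (by simp), hbd (-1) (by simp)] with x h1 h2
      rw [Real.norm_eq_abs, abs_le]
      constructor <;> linarith
    have hint : ∀ h : Lp ℝ 1 μ, Integrable (fun x => f x * h x) μ := fun h =>
      (L1.integrable_coeFn h).bdd_mul (Lp.aestronglyMeasurable f) hae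
    intro h
    induction h using Lp.induction (hp_ne_top := ENNReal.one_ne_top) with
    | indicatorConst c hs hμs =>
      rw [Lp.simpleFunc.coe_indicatorConst, hind c _ hs, ← integral_indicator hs]
      refine integral_congr_ae ?_
      filter_upwards [indicatorConstLp_coeFn (p := 1) (hs := hs) (hμs := hμs.ne) (c := c)]
        with x hx
      rw [hx]
      rename_i s
      by_cases h : x ∈ s <;> simp [h]
    | @add u v hu hv _ h1 h2 =>
      rw [map_add, h1, h2, ← integral_add (hint _) (hint _)]
      refine integral_congr_ae ?_
      filter_upwards [Lp.coeFn_add (hu.toLp u) (hv.toLp v)] with x hx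
      rw [hx, Pi.add_apply, mul_add]
    | isClosed =>
      refine isClosed_eq Λ.continuous ?_
      let B : Lp ℝ 1 μ →ₗ[ℝ] ℝ :=
        { toFun := fun h => ∫ x, f x * h x ∂μ
          map_add' := fun u v => by
            rw [← integral_add (hint _) (hint _)]
            refine integral_congr_ae ?_
            filter_upwards [Lp.coeFn_add u v] with x hx
            rw [hx, Pi.add_apply, mul_add]
          map_smul' := fun c u => by
            rw [RingHom.id_apply, smul_eq_mul, ← integral_const_mul]
            refine integral_congr_ae ?_
            filter_upwards [Lp.coeFn_smul c u] with x hx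
            rw [hx, Pi.smul_apply, smul_eq_mul]; ring }
      refine (B.mkContinuous ‖Λ‖ fun h => ?_).continuous
      rw [L1.norm_eq_integral_norm, ← integral_const_mul]
      refine norm_integral_le_of_norm_le ((L1.integrable_coeFn h).norm.const_mul _) ?_
      filter_upwards [hae] with x hx
      rw [norm_mul]
      exact mul_le_mul_of_nonneg_right hx (norm_nonneg _)

/-- Hahn–Banach for a functional that is controlled through a linear map. -/
theorem exists_dual_comp_eq {T F : Type*} [AddCommGroup T] [Module ℝ T]
    [NormedAddCommGroup F] [NormedSpace ℝ F] (A : T →ₗ[ℝ] F) (ℓ : T →ₗ[ℝ] ℝ) (c : ℝ)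
    (h : ∀ φ, |ℓ φ| ≤ c * ‖A φ‖) : ∃ Λ : StrongDual ℝ F, ∀ φ, Λ (A φ) = ℓ φ := by
  have hk : LinearMap.ker A ≤ LinearMap.ker ℓ := by
    intro φ hφ
    have := h φ
    rw [LinearMap.mem_ker.1 hφ, norm_zero, mul_zero] at this
    exact abs_nonpos_iff.1 this
  let ℓ' : LinearMap.range A →ₗ[ℝ] ℝ :=
    ((LinearMap.ker A).liftQ ℓ hk).comp A.quotKerEquivRange.symm.toLinearMap
  have hl : ∀ φ, ℓ' ⟨A φ, φ, rfl⟩ = ℓ φ := by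
    intro φ
    have : A.quotKerEquivRange.symm ⟨A φ, φ, rfl⟩ = (LinearMap.ker A).mkQ φ := by
      rw [LinearEquiv.symm_apply_eq]; rfl
    simp [ℓ', this]
  obtain ⟨Λ, hΛ, -⟩ := exists_extension_norm_eq (LinearMap.range A) (ℓ'.mkContinuous c (by
    rintro ⟨_, φ, rfl⟩
    rw [hl]
    exact h φ))
  exact ⟨Λ, fun φ => (hΛ ⟨A φ, φ, rfl⟩).trans (hl φ)⟩

/-- A functional on a space of test functions that is controlled in `L_{1,-n}` through a linear map
is represented by a function of `L_{∞,n}`. -/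
theorem exists_weightedLinf_repr {d n : ℕ} {T : Type*} [AddCommGroup T] [Module ℝ T]
    (A : T →ₗ[ℝ] weightedL1 d n) (ℓ : T →ₗ[ℝ] ℝ) (c : ℝ)
    (h : ∀ φ, |ℓ φ| ≤ c * ∫ x, |(A φ : Fun d) x| * (1 + ‖x‖) ^ n) :
    ∃ f ∈ weightedLinf d n, ∀ φ, ∫ x, f x * (A φ : Fun d) x = ℓ φ := by
  have hpos : ∀ x : E d, 0 < 1 + ‖x‖ := fun x => by positivity
  -- The exponent exceeds the dimension, so `k` is integrable and `μ` finite.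
  let k : E d → ℝ := fun x => (1 + ‖x‖) ^ (-((d : ℝ) + 1))
  have hkpos : ∀ x, 0 < k x := fun x => Real.rpow_pos_of_pos (hpos x) _
  have hkm : Measurable k := by fun_prop
  have hki : Integrable k := integrable_one_add_norm (by simp)
  let μ : Measure (E d) := volume.withDensity fun x => ENNReal.ofReal (k x)
  have : IsFiniteMeasure μ := isFiniteMeasure_withDensity_ofReal hki.2
  have hac : (volume : Measure (E d)) ≪ μ :=
    withDensity_absolutelyContinuous' hkm.ennreal_ofReal.aemeasurable
      (ae_of_all _ fun x => (ENNReal.ofReal_pos.2 (hkpos x)).ne')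
  have hca : μ ≪ (volume : Measure (E d)) := withDensity_absolutelyContinuous _ _
  have hI : ∀ g : E d → ℝ, ∫ x, g x ∂μ = ∫ x, k x * g x := by
    intro g
    rw [integral_withDensity_eq_integral_toReal_smul hkm.ennreal_ofReal (by simp)]
    simp [ENNReal.toReal_ofReal (hkpos _).le]
  have hJ : ∀ g : E d → ℝ, Integrable g μ ↔ Integrable fun x => k x * g x := by
    intro g
    rw [integrable_withDensity_iff_integrable_smul' hkm.ennreal_ofReal (by simp)]
    simp [ENNReal.toReal_ofReal (hkpos _).le]
  -- The factor `k⁻¹` offsets the density of `μ`, so that `ψ ↦ ψ w` is isometric from weighted `L¹`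
  -- into `L¹(μ)`.
  let w : E d → ℝ := fun x => (1 + ‖x‖) ^ n * (k x)⁻¹
  have hkw : ∀ (ψ : Fun d) x, k x * (ψ x * w x) = ψ x * (1 + ‖x‖) ^ n := by
    intro ψ x
    have := (hkpos x).ne'
    simp only [w]; field_simp
  have hint : ∀ ψ : weightedL1 d n, Integrable (fun x => (ψ : Fun d) x * w x) μ := by
    intro ψ
    rw [hJ]
    simp_rw [hkw]
    exact ψ.2
  let B : weightedL1 d n →ₗ[ℝ] Lp ℝ 1 μ :=
    { toFun := fun ψ => (hint ψ).toL1
      map_add' := fun u v => by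
        rw [← Integrable.toL1_add, Integrable.toL1_eq_toL1_iff]
        filter_upwards [hca.ae_le (AEEqFun.coeFn_add (u : Fun d) v)] with x hx
        simp [hx, add_mul]
      map_smul' := fun c u => by
        rw [RingHom.id_apply, ← Integrable.toL1_smul, Integrable.toL1_eq_toL1_iff]
        filter_upwards [hca.ae_le (AEEqFun.coeFn_smul c (u : Fun d))] with x hx
        simp [hx, mul_assoc] }
  have hB : ∀ ψ, ‖B ψ‖ = ∫ x, |(ψ : Fun d) x| * (1 + ‖x‖) ^ n := by
    intro ψ
    rw [L1.norm_eq_integral_norm]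
    have : ∫ x, ‖(B ψ) x‖ ∂μ = ∫ x, ‖(ψ : Fun d) x * w x‖ ∂μ := by
      refine integral_congr_ae ?_
      filter_upwards [(hint ψ).coeFn_toL1] with x hx
      exact congrArg norm hx
    rw [this, hI]
    refine integral_congr_ae (ae_of_all _ fun x => ?_)
    have h1 := hkw ψ x
    have h2 : (0 : ℝ) ≤ (1 + ‖x‖) ^ n := by positivity
    simp only
    rw [Real.norm_eq_abs, ← abs_of_pos (hkpos x), ← abs_mul, h1, abs_mul,
      abs_of_nonneg h2]
  obtain ⟨Λ, hΛ⟩ := exists_dual_comp_eq (B.comp A) ℓ c fun φ => by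
    rw [LinearMap.comp_apply, hB]; exact h φ
  obtain ⟨f, hfm, hfb, hf⟩ := exists_bounded_repr_of_dual_L1 μ Λ
  have hFm : AEStronglyMeasurable (fun x => f x * (1 + ‖x‖) ^ n) (volume : Measure (E d)) := by
    exact (hfm.mul (by fun_prop : Continuous fun x : E d => (1 + ‖x‖) ^ n).stronglyMeasurable
      ).aestronglyMeasurable
  refine ⟨AEEqFun.mk _ hFm, ⟨‖Λ‖, ?_⟩, fun φ => ?_⟩
  · filter_upwards [AEEqFun.coeFn_mk _ hFm, hac.ae_le hfb] with x hx hb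
    have h2 : (0 : ℝ) ≤ (1 + ‖x‖) ^ n := by positivity
    rw [hx, abs_mul, abs_of_nonneg h2]
    exact mul_le_mul_of_nonneg_right hb h2
  · rw [← hΛ φ, hf, hI]
    refine integral_congr_ae ?_
    filter_upwards [AEEqFun.coeFn_mk _ hFm, hac.ae_le (hint (A φ)).coeFn_toL1] with x hx hy
    have h1 := hkw (A φ) x
    have h3 : (B.comp A φ : Lp ℝ 1 μ) x = (A φ : Fun d) x * w x := hy
    rw [hx, h3, mul_left_comm, h1]; ring

/-! ### Products of a measure with a function -/

variable {d : ℕ}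

theorem abs_apply_le_norm (φ : C₀(E d, ℝ)) (x : E d) : |φ x| ≤ ‖φ‖ := by
  rw [← ZeroAtInftyContinuousMap.norm_toBCF_eq_norm]
  exact φ.toBCF.norm_coe_le_norm x

theorem norm_le_of_forall_abs_le {φ : C₀(E d, ℝ)} {c : ℝ} (hc : 0 ≤ c) (h : ∀ x, |φ x| ≤ c) :
    ‖φ‖ ≤ c := by
  rw [← ZeroAtInftyContinuousMap.norm_toBCF_eq_norm]
  exact (BoundedContinuousFunction.norm_le hc).2 h

/-- A compactly supported continuous function, as a function vanishing at infinity. -/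
def ofCompactSupport (f : C(E d, ℝ)) (hf : HasCompactSupport f) : C₀(E d, ℝ) where
  toContinuousMap := f
  zero_at_infty' := hf.is_zero_at_infty

@[simp] theorem coe_ofCompactSupport (f : C(E d, ℝ)) (hf : HasCompactSupport f) :
    ⇑(ofCompactSupport f hf) = f := rfl

/-- The measure `g w`, as a function of the density `g`. -/
def mulMeasure (w : M d) : C₀(E d, ℝ) →ₗ[ℝ] M d where
  toFun g := w.comp (ContinuousLinearMap.mul ℝ C₀(E d, ℝ) g)
  map_add' g h := by ext φ; simp
  map_smul' c g := by ext φ; simp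

@[simp] theorem mulMeasure_apply (w : M d) (g φ : C₀(E d, ℝ)) :
    mulMeasure w g φ = w (g * φ) := rfl

@[simp] theorem dirac_apply (y : E d) (φ : C₀(E d, ℝ)) : dirac y φ = φ y := rfl

/-- Since `1 ± g ≥ 0`, test functions bounded by one satisfy `|(1 + g) φ + (1 - g) ψ| ≤ (1 + g) + (1
- g) = 2` pointwise. -/
theorem norm_add_add_norm_sub_le (w : M d) (g : C₀(E d, ℝ)) (hg : ‖g‖ ≤ 1) :
    ‖w + mulMeasure w g‖ + ‖w - mulMeasure w g‖ ≤ 2 * ‖w‖ := by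
  have key : ∀ φ ψ : C₀(E d, ℝ), ‖φ‖ ≤ 1 → ‖ψ‖ ≤ 1 →
      (w + mulMeasure w g) φ + (w - mulMeasure w g) ψ ≤ 2 * ‖w‖ := by
    intro φ ψ hφ hψ
    have h1 : (w + mulMeasure w g) φ + (w - mulMeasure w g) ψ
        = w (φ + g * φ + (ψ - g * ψ)) := by simp
    have h2 : ‖φ + g * φ + (ψ - g * ψ)‖ ≤ 2 := by
      refine norm_le_of_forall_abs_le (by norm_num) fun x => ?_
      have a := (abs_le.1 ((abs_apply_le_norm φ x).trans hφ))
      have b := (abs_le.1 ((abs_apply_le_norm ψ x).trans hψ))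
      have c := (abs_le.1 ((abs_apply_le_norm g x).trans hg))
      simp only [ZeroAtInftyContinuousMap.add_apply, ZeroAtInftyContinuousMap.mul_apply,
        ZeroAtInftyContinuousMap.sub_apply]
      rw [abs_le]
      constructor <;> nlinarith
    rw [h1]
    refine (le_abs_self _).trans ((w.le_opNorm _).trans ?_)
    rw [mul_comm]
    exact mul_le_mul_of_nonneg_right h2 (norm_nonneg _)
  have pos : ∀ (u : M d) (r : ℝ), r < ‖u‖ → ∃ φ : C₀(E d, ℝ), ‖φ‖ ≤ 1 ∧ r < u φ := by
    intro u r hr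
    obtain ⟨φ, h1, h2⟩ := u.exists_lt_apply_of_lt_opNorm hr
    rcases le_or_gt 0 (u φ) with h | h
    · exact ⟨φ, h1.le, by rwa [Real.norm_of_nonneg h] at h2⟩
    · exact ⟨-φ, by rw [norm_neg]; exact h1.le, by rwa [Real.norm_of_nonpos h.le, ← map_neg] at h2⟩
  by_contra! hlt
  obtain ⟨ε, hε, h⟩ : ∃ ε > 0, 2 * ‖w‖ + 2 * ε
      = ‖w + mulMeasure w g‖ + ‖w - mulMeasure w g‖ :=
    ⟨(‖w + mulMeasure w g‖ + ‖w - mulMeasure w g‖ - 2 * ‖w‖) / 2, by linarith, by ring⟩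
  obtain ⟨φ, h1, h2⟩ := pos (w + mulMeasure w g) (‖w + mulMeasure w g‖ - ε) (by linarith)
  obtain ⟨ψ, h3, h4⟩ := pos (w - mulMeasure w g) (‖w - mulMeasure w g‖ - ε) (by linarith)
  linarith [key φ ψ h1 h3]

/-! ### Measures in the range of `L` -/

namespace Operator

variable {n : ℕ} {L : Operator d n} {ρ : Fun d}

theorem maps_toFun (L : Operator d n) (f : L.nativeSpace) : L.Maps f (L.toFun f) :=
  f.2.2.choose_spec

theorem toFun_eq_of_maps {f : L.nativeSpace} {w : M d} (h : L.Maps f w) : L.toFun f = w :=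
  (L.maps_toFun f).unique h

theorem SplineAdmissible.exists_shift_green (hL : L.SplineAdmissible ρ) (y : E d) :
    ∃ h : shift y ρ ∈ L.nativeSpace, L.toFun ⟨shift y ρ, h⟩ = dirac y := by
  obtain ⟨h0, h1⟩ := hL.green
  obtain ⟨h, h2⟩ := hL.shift_invariant ⟨ρ, h0⟩ y
  refine ⟨h, ?_⟩
  ext φ
  rw [h2, h1]
  simp [shiftC0]

theorem coeFn_shift (y : E d) (f : Fun d) : shift y f =ᵐ[volume] fun x => f (x - y) :=
  AEEqFun.coeFn_compMeasurePreserving f (measurePreserving_sub_right volume y)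

/-- Shifting the Green's function gives `φ(y) = ∫ ρ(x - y) (L⋆ φ)(x) dx`, and the growth of `ρ(x -
y)` splits into a factor in `y` and one in `x`. -/
theorem SplineAdmissible.exists_abs_test_le (hL : L.SplineAdmissible ρ) :
    ∃ c ≥ 0, ∀ (φ : L.test) (y : E d), |(φ : C₀(E d, ℝ)) y| ≤
      c * (1 + ‖y‖) ^ n * ∫ x, |(L.adj φ : Fun d) x| * (1 + ‖x‖) ^ n := by
  obtain ⟨c, hc⟩ := hL.growth.1
  refine ⟨|c|, abs_nonneg c, fun φ y => ?_⟩
  obtain ⟨h, h1⟩ := hL.exists_shift_green y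
  have h2 := L.maps_toFun ⟨shift y ρ, h⟩ φ
  rw [h1, dirac_apply] at h2
  rw [← h2, ← Real.norm_eq_abs, ← integral_const_mul]
  have hi : Integrable fun x => |(L.adj φ : Fun d) x| * (1 + ‖x‖) ^ n := by
    have : Integrable fun x => (L.adj φ : Fun d) x * (1 + ‖x‖) ^ n := (L.adj φ).2
    refine this.norm.congr (ae_of_all _ fun x => ?_)
    have h0 : (0 : ℝ) ≤ (1 + ‖x‖) ^ n := by positivity
    simp only [Real.norm_eq_abs, abs_mul, abs_of_nonneg h0]
  refine norm_integral_le_of_norm_le (hi.const_mul _) ?_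
  filter_upwards [coeFn_shift y ρ,
    (measurePreserving_sub_right volume y).quasiMeasurePreserving.ae hc] with x hx hx'
  have h3 : (1 + ‖x - y‖) ^ n ≤ (1 + ‖y‖) ^ n * (1 + ‖x‖) ^ n := by
    rw [← mul_pow]
    refine pow_le_pow_left₀ (by positivity) ?_ n
    nlinarith [norm_sub_le x y, norm_nonneg x, norm_nonneg y,
      mul_nonneg (norm_nonneg x) (norm_nonneg y)]
  rw [Real.norm_eq_abs, abs_mul]
  simp only [hx]
  calc |ρ (x - y)| * |(L.adj φ : Fun d) x|
      ≤ (|c| * ((1 + ‖y‖) ^ n * (1 + ‖x‖) ^ n)) * |(L.adj φ : Fun d) x| := by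
        refine mul_le_mul_of_nonneg_right (hx'.trans ?_) (abs_nonneg _)
        exact mul_le_mul (le_abs_self c) h3 (by positivity) (abs_nonneg c)
    _ = _ := by ring

/-- Every compactly supported part of a finite measure is in the range of `L`. -/
theorem SplineAdmissible.exists_toFun_eq_mulMeasure (hL : L.SplineAdmissible ρ) (w : M d)
    (g : C₀(E d, ℝ)) (hg : HasCompactSupport g) :
    ∃ f : L.nativeSpace, L.toFun f = mulMeasure w g := by
  obtain ⟨c, hc0, hc⟩ := hL.exists_abs_test_le
  obtain ⟨r, hr⟩ := hg.isCompact.isBounded.exists_norm_le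
  -- On the support of `g` the factor `(1 + ‖y‖)^n` is bounded, so `φ ↦ w(g φ)` is controlled by the
  -- weighted `L¹` norm of `L⋆ φ`. The absolute value `|r|` covers an empty support, where `r` may
  -- be negative.
  have hbound : ∀ φ : L.test, |w (g * (φ : C₀(E d, ℝ)))| ≤ (‖w‖ * (‖g‖ * (c * (1 + |r|) ^ n))) *
      ∫ x, |(L.adj φ : Fun d) x| * (1 + ‖x‖) ^ n := by
    intro φ
    have hI : 0 ≤ ∫ x, |(L.adj φ : Fun d) x| * (1 + ‖x‖) ^ n :=
      integral_nonneg fun x => by positivity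
    refine (w.le_opNorm _).trans ?_
    rw [mul_assoc]
    refine mul_le_mul_of_nonneg_left ?_ (norm_nonneg w)
    refine norm_le_of_forall_abs_le (by positivity) fun x => ?_
    rw [ZeroAtInftyContinuousMap.mul_apply, abs_mul]
    by_cases hx : x ∈ tsupport g
    · rw [mul_assoc]
      refine mul_le_mul (abs_apply_le_norm g x) ((hc φ x).trans ?_) (abs_nonneg _) (norm_nonneg g)
      have : ‖x‖ ≤ |r| := (hr x hx).trans (le_abs_self r)
      gcongr
    · rw [image_eq_zero_of_notMem_tsupport hx, abs_zero, zero_mul]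
      positivity
  let ℓ : L.test →ₗ[ℝ] ℝ := (mulMeasure w g).toLinearMap.comp L.test.subtype
  obtain ⟨f, hf, hfw⟩ := exists_weightedLinf_repr (T := L.test) (d := d) (n := n) L.adj ℓ
    (‖w‖ * (‖g‖ * (c * (1 + |r|) ^ n))) hbound
  exact ⟨⟨f, hf, mulMeasure w g, hfw⟩, toFun_eq_of_maps hfw⟩

end Operator

/-! ### Supports and Dirac combinations -/

/-- If `w` vanishes on all functions that vanish on a finite set, it is a combination of Dirac
impulses there. -/
theorem exists_eq_sum_dirac {K : ℕ} (x : Fin K → E d) (w : M d)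
    (h : ∀ φ : C₀(E d, ℝ), (∀ k, φ (x k) = 0) → w φ = 0) :
    ∃ a : Fin K → ℝ, w = ∑ k, a k • dirac (x k) := by
  have h1 : w.toLinearMap ∈ Submodule.span ℝ
      (range fun k => (dirac (x k)).toLinearMap) := by
    refine mem_span_of_iInf_ker_le_ker fun φ hφ => ?_
    simp only [Submodule.mem_iInf, LinearMap.mem_ker] at hφ ⊢
    exact h φ hφ
  obtain ⟨a, ha⟩ := (Submodule.mem_span_range_iff_exists_fun ℝ).1 h1
  refine ⟨a, ?_⟩
  ext φ
  have := LinearMap.congr_fun ha φ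
  simpa using this.symm

/-- The lower bound uses a difference of two Urysohn functions that takes the value `1` at knots
with `a k ≥ 0` and `-1` at the others. -/
theorem norm_sum_dirac {K : ℕ} {x : Fin K → E d} (hx : Function.Injective x) (a : Fin K → ℝ) :
    ‖∑ k, a k • dirac (x k)‖ = ∑ k, |a k| := by
  apply le_antisymm
  · refine ContinuousLinearMap.opNorm_le_bound _ (Finset.sum_nonneg fun k _ => abs_nonneg _) ?_
    intro φ
    rw [sum_apply, Finset.sum_mul]
    refine (norm_sum_le _ _).trans (Finset.sum_le_sum fun k _ => ?_)
    rw [smul_apply, smul_eq_mul, norm_mul, dirac_apply]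
    exact mul_le_mul_of_nonneg_left (abs_apply_le_norm φ _) (norm_nonneg _)
  · have hfin : ∀ s : Set (Fin K), IsCompact (x '' s) := fun s => (s.toFinite.image x).isCompact
    have hdis : Disjoint (x '' {k | 0 ≤ a k}) (x '' {k | a k < 0}) := by
      rw [disjoint_image_iff hx, Set.disjoint_left]
      intro k h1 h2
      exact not_le.2 (show a k < 0 from h2) h1
    obtain ⟨f, f1, f0, fc, f01⟩ := exists_continuous_one_zero_of_isCompact (hfin _)
      (hfin _).isClosed hdis
    obtain ⟨g, g1, g0, gc, g01⟩ := exists_continuous_one_zero_of_isCompact (hfin _)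
      (hfin _).isClosed hdis.symm
    let φ := ofCompactSupport f fc - ofCompactSupport g gc
    have hφ : ‖φ‖ ≤ 1 := norm_le_of_forall_abs_le zero_le_one fun y => by
      have h1 := f01 y
      have h2 := g01 y
      simp only [φ, ZeroAtInftyContinuousMap.sub_apply, coe_ofCompactSupport]
      rw [abs_le]
      constructor <;> linarith [h1.1, h1.2, h2.1, h2.2]
    have hv : (∑ k, a k • dirac (x k)) φ = ∑ k, |a k| := by
      rw [sum_apply]
      refine Finset.sum_congr rfl fun k _ => ?_
      simp only [smul_apply, smul_eq_mul, dirac_apply, φ, ZeroAtInftyContinuousMap.sub_apply,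
        coe_ofCompactSupport]
      rcases le_or_gt 0 (a k) with h | h
      · rw [f1 (mem_image_of_mem x h), g0 (mem_image_of_mem x h), abs_of_nonneg h]; simp
      · rw [f0 (mem_image_of_mem x h), g1 (mem_image_of_mem x h), abs_of_neg h]; simp
    rw [← hv]
    refine (le_abs_self _).trans (((∑ k, a k • dirac (x k) : M d).le_opNorm φ).trans ?_)
    exact mul_le_of_le_one_right (norm_nonneg _) hφ

/-- The support of a measure. -/
def measureSupport (w : M d) : Set (E d) :=
  {x | ∀ U, IsOpen U → x ∈ U → ∃ φ : C₀(E d, ℝ), HasCompactSupport φ ∧ tsupport φ ⊆ U ∧ w φ ≠ 0}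

/-- Off the support `w` vanishes locally; a partition of unity on a finite subcover splits `φ` into
local pieces. -/
theorem apply_eq_zero_of_disjoint_measureSupport (w : M d) (φ : C₀(E d, ℝ))
    (hc : HasCompactSupport φ) (hφ : Disjoint (tsupport φ) (measureSupport w)) : w φ = 0 := by
  have hU : ∀ x ∈ tsupport φ, ∃ U, IsOpen U ∧ x ∈ U ∧
      ∀ ψ : C₀(E d, ℝ), HasCompactSupport ψ → tsupport ψ ⊆ U → w ψ = 0 := by
    intro x hx
    have := Set.disjoint_left.1 hφ hx
    simp only [measureSupport, mem_ofPred_eq] at this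
    push Not at this
    exact this
  choose! U hUo hxU hUw using hU
  obtain ⟨t, hcov⟩ := hc.isCompact.elim_nhds_subcover' (fun x _ => U x)
    (fun x hx => (hUo x hx).mem_nhds (hxU x hx))
  let e := t.equivFin.symm
  obtain ⟨f, fU, f1, -, fc⟩ := exists_continuous_sum_one_of_isOpen_isCompact
    (s := fun i => U (e i : tsupport φ)) (fun i => hUo _ (e i : tsupport φ).2) hc.isCompact
    (fun y hy => by
      obtain ⟨x, hx, hy⟩ := mem_iUnion₂.1 (hcov hy)
      exact mem_iUnion.2 ⟨e.symm ⟨x, hx⟩, by simpa using hy⟩)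
  have hsum : φ = ∑ i, ofCompactSupport (f i) (fc i) * φ := by
    ext y
    have hs : (∑ i, ofCompactSupport (f i) (fc i) * φ) y = ∑ i, f i y * φ y := by
      exact map_sum (dirac y) (fun i => ofCompactSupport (f i) (fc i) * φ) Finset.univ
    rw [hs, ← Finset.sum_mul]
    by_cases hy : y ∈ tsupport φ
    · have := f1 hy
      simp only [Finset.sum_apply, Pi.one_apply] at this
      rw [this, one_mul]
    · rw [image_eq_zero_of_notMem_tsupport hy, mul_zero]
  rw [hsum, map_sum]
  refine Finset.sum_eq_zero fun i _ => hUw _ (e i : tsupport φ).2 _ ?_ ?_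
  · exact (fc i).mul_right
  · exact (tsupport_mul_subset_left (f := f i) (g := φ)).trans (fU i)

/-- A measure kills the functions that vanish on its support. -/
theorem apply_eq_zero_of_eqOn_measureSupport (w : M d) (φ : C₀(E d, ℝ))
    (hφ : ∀ x ∈ measureSupport w, φ x = 0) : w φ = 0 := by
  have key : ∀ ε > 0, |w φ| ≤ ‖w‖ * ε := by
    intro ε hε
    have hcl : IsClosed {y | ε ≤ |φ y|} :=
      isClosed_le continuous_const (map_continuous φ).abs
    have hcpt : IsCompact {y | ε ≤ |φ y|} := by
      have h0 := (zero_at_infty φ).eventually (Metric.ball_mem_nhds 0 hε)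
      obtain ⟨k, hk, hk'⟩ := Filter.mem_cocompact.1 h0
      refine hk.of_isClosed_subset hcl fun y hy => ?_
      by_contra hyk
      have := hk' hyk
      simp only [mem_ofPred_eq, dist_zero_right,
        Real.norm_eq_abs] at this hy
      linarith
    -- Subtracting the truncation of `φ` to `[-ε, ε]` leaves a compactly supported function within
    -- `ε` of `φ`, whose support avoids that of `w`.
    let f : C(E d, ℝ) := ⟨fun y => φ y - max (-ε) (min ε (φ y)), by fun_prop⟩
    have hf0 : ∀ y, y ∉ {y | ε ≤ |φ y|} → f y = 0 := by
      intro y hy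
      simp only [mem_ofPred_eq, not_le, abs_lt] at hy
      simp only [f, ContinuousMap.coe_mk]
      rw [min_eq_right hy.2.le, max_eq_right hy.1.le, sub_self]
    have hfc : HasCompactSupport f := HasCompactSupport.intro hcpt hf0
    have hfs : tsupport f ⊆ {y | ε ≤ |φ y|} :=
      closure_minimal (fun y hy => by by_contra h; exact hy (hf0 y h)) hcl
    have hwf := apply_eq_zero_of_disjoint_measureSupport w (ofCompactSupport f hfc) hfc (by
      refine Set.disjoint_left.2 fun y hy hy' => ?_
      have h1 : ε ≤ |φ y| := hfs hy
      rw [hφ y hy', abs_zero] at h1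
      linarith)
    have hd : ‖φ - ofCompactSupport f hfc‖ ≤ ε := norm_le_of_forall_abs_le hε.le fun y => by
      simp only [ZeroAtInftyContinuousMap.sub_apply, coe_ofCompactSupport, f,
        ContinuousMap.coe_mk, sub_sub_cancel]
      rw [abs_le]
      exact ⟨le_max_left _ _, max_le (by linarith) (min_le_left _ _)⟩
    calc |w φ| = |w (φ - ofCompactSupport f hfc)| := by rw [map_sub, hwf, sub_zero]
      _ ≤ ‖w‖ * ‖φ - ofCompactSupport f hfc‖ := w.le_opNorm _
      _ ≤ ‖w‖ * ε := mul_le_mul_of_nonneg_left hd (norm_nonneg w)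
  by_contra hne
  have hp : 0 < |w φ| := abs_pos.2 hne
  have h1 := key (|w φ| / (2 * (‖w‖ + 1))) (by positivity)
  have h2 : ‖w‖ * (|w φ| / (2 * (‖w‖ + 1))) ≤ |w φ| / 2 := by
    rw [mul_div_assoc', div_le_div_iff₀ (by positivity) (by positivity)]
    nlinarith [norm_nonneg w]
  linarith

/-- If the compactly supported parts of `w` span a space of dimension at most `m`, then `w` is a
combination of at most `m` Dirac impulses. -/
theorem exists_eq_sum_dirac_of_dependent (w : M d) (m : ℕ)
    (h : ∀ g : Fin (m + 1) → C₀(E d, ℝ), (∀ i, HasCompactSupport (g i)) →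
      ∃ t : Fin (m + 1) → ℝ, t ≠ 0 ∧ mulMeasure w (∑ i, t i • g i) = 0) :
    ∃ K ≤ m, ∃ (a : Fin K → ℝ) (x : Fin K → E d), Function.Injective x ∧
      w = ∑ k, a k • dirac (x k) := by
  -- Around `m + 1` support points take disjoint open sets, in each a `φ i` with `w (φ i) ≠ 0`, and
  -- a bump `g i` equal to one on its support. Testing the vanishing combination on `φ i` gives `t i
  -- = 0` for every `i`.
  have hcard : (measureSupport w).encard ≤ m := by
    by_contra hlt
    have hle : ((m + 1 : ℕ) : ℕ∞) ≤ (measureSupport w).encard := by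
      push_cast
      exact Order.add_one_le_of_lt (not_le.1 hlt)
    obtain ⟨s, hs, hsc⟩ := exists_subset_encard_eq hle
    have hsf : s.Finite := finite_of_encard_eq_coe hsc
    obtain ⟨U, hU, hdis⟩ := hsf.t2_separation
    have : Fintype s := hsf.fintype
    have hc : Fintype.card s = m + 1 := by
      rw [← Nat.card_eq_fintype_card, Nat.card_coe_set_eq, ncard_def, hsc]; rfl
    let e : Fin (m + 1) ≃ s := (Fintype.equivFinOfCardEq hc).symm
    choose φ hφc hφU hφw using fun i => hs (e i).2 (U (e i)) (hU _).2 (hU _).1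
    choose g g1 g0 gc g01 using fun i => exists_continuous_one_zero_of_isCompact
      (hφc i).isCompact (hU (e i)).2.isClosed_compl
      (disjoint_compl_right_iff_subset.2 (hφU i))
    obtain ⟨t, ht, htw⟩ := h (fun i => ofCompactSupport (g i) (gc i)) gc
    refine ht (funext fun i => ?_)
    have h1 : (∑ j, t j • ofCompactSupport (g j) (gc j)) * φ i = t i • φ i := by
      ext y
      have hs : (∑ j, t j • ofCompactSupport (g j) (gc j)) y = ∑ j, t j * g j y := by
        exact map_sum (dirac y) (fun j => t j • ofCompactSupport (g j) (gc j)) Finset.univ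
      rw [ZeroAtInftyContinuousMap.mul_apply, hs, ZeroAtInftyContinuousMap.smul_apply,
        smul_eq_mul]
      by_cases hy : y ∈ tsupport (φ i)
      · rw [Finset.sum_eq_single i]
        · rw [g1 i hy]; simp
        · intro j _ hji
          have hyj : y ∉ U (e j) := fun hyj => by
            refine Set.disjoint_left.1 (hdis (e j).2 (e i).2 ?_) hyj (hφU i hy)
            exact fun hh => hji (e.injective (Subtype.ext hh))
          rw [g0 j hyj]; simp
        · simp
      · rw [image_eq_zero_of_notMem_tsupport hy]; simp
    have h2 := congrArg (fun v : M d => v (φ i)) htw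
    simp only [mulMeasure_apply, h1, map_smul, smul_eq_mul, zero_apply] at h2
    exact (mul_eq_zero.1 h2).resolve_right (hφw i)
  have hfin : (measureSupport w).Finite := finite_of_encard_le_coe hcard
  have : Fintype (measureSupport w) := hfin.fintype
  let e := (Fintype.equivFin (measureSupport w)).symm
  obtain ⟨a, ha⟩ := exists_eq_sum_dirac (fun k => (e k : E d)) w fun φ hφ => by
    refine apply_eq_zero_of_eqOn_measureSupport w φ fun x hx => ?_
    simpa using hφ (e.symm ⟨x, hx⟩)
  refine ⟨_, ?_, a, fun k => e k, Subtype.val_injective.comp e.injective, ha⟩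
  rw [← Nat.card_eq_fintype_card, Nat.card_coe_set_eq]
  exact_mod_cast hfin.cast_ncard_eq.trans_le hcard

/-! ### Sparsity of extreme minimizers -/

/-- The minimizers of the total variation of `Λ f` under the constraint `ν f ∈ C`. -/
def minimizers {X : Type*} [AddCommGroup X] [Module ℝ X] {m : ℕ} (Λ : X →ₗ[ℝ] M d)
    (ν : X →ₗ[ℝ] (Fin m → ℝ)) (C : Set (Fin m → ℝ)) : Set X :=
  {f | ν f ∈ C ∧ ∀ g, ν g ∈ C → ‖Λ f‖ ≤ ‖Λ g‖}

section minimizers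

variable {X : Type*} [AddCommGroup X] [Module ℝ X] {m : ℕ} {Λ : X →ₗ[ℝ] M d}
  {ν : X →ₗ[ℝ] (Fin m → ℝ)} {C : Set (Fin m → ℝ)}

theorem convex_minimizers (hC : Convex ℝ C) : Convex ℝ (minimizers Λ ν C) := by
  intro f hf g hg a b ha hb hab
  refine ⟨?_, fun h hh => ?_⟩
  · rw [map_add, map_smul, map_smul]
    exact hC hf.1 hg.1 ha hb hab
  · rw [map_add, map_smul, map_smul]
    calc ‖a • Λ f + b • Λ g‖ ≤ ‖a • Λ f‖ + ‖b • Λ g‖ := ContinuousLinearMap.opNorm_add_le _ _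
      _ ≤ a * ‖Λ f‖ + b * ‖Λ g‖ := by
        refine add_le_add ((ContinuousLinearMap.opNorm_smul_le a _).trans_eq ?_)
          ((ContinuousLinearMap.opNorm_smul_le b _).trans_eq ?_)
        · rw [Real.norm_of_nonneg ha]
        · rw [Real.norm_of_nonneg hb]
      _ ≤ a * ‖Λ h‖ + b * ‖Λ h‖ := by gcongr; exacts [hf.2 h hh, hg.2 h hh]
      _ = ‖Λ h‖ := by rw [← add_mul, hab, one_mul]

/-- If the range of `Λ` contains the compactly supported parts of its elements, then `Λ` maps the
extreme minimizers to combinations of at most `m` Dirac impulses. -/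
theorem exists_eq_sum_dirac_of_mem_extremePoints
    (hmul : ∀ (f : X) (g : C₀(E d, ℝ)), HasCompactSupport g → ∃ f', Λ f' = mulMeasure (Λ f) g)
    {s : X} (hs : s ∈ (minimizers Λ ν C).extremePoints ℝ) :
    ∃ K ≤ m, ∃ (a : Fin K → ℝ) (x : Fin K → E d), Function.Injective x ∧
      Λ s = ∑ k, a k • dirac (x k) := by
  refine exists_eq_sum_dirac_of_dependent (Λ s) m fun g hg => ?_
  choose F hF using fun i => hmul s (g i) (hg i)
  have hdep : ¬ LinearIndependent ℝ (fun i => ν (F i)) := fun hli => by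
    have := hli.fintype_card_le_finrank
    simp at this
  obtain ⟨t, ht, i, hi⟩ := Fintype.not_linearIndependent_iff.1 hdep
  refine ⟨t, fun h => hi (congrFun h i), ?_⟩
  let G := ∑ i, t i • g i
  let H := ∑ i, t i • F i
  have hΛ : Λ H = mulMeasure (Λ s) G := by
    simp only [H, G, map_sum, map_smul, hF]
  have hν : ν H = 0 := by simpa only [H, map_sum, map_smul] using ht
  obtain ⟨ε, hε, hG⟩ : ∃ ε : ℝ, 0 < ε ∧ ‖ε • G‖ ≤ 1 := by
    refine ⟨(‖G‖ + 1)⁻¹, by positivity, ?_⟩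
    rw [norm_smul, norm_inv, Real.norm_of_nonneg (by positivity), inv_mul_le_iff₀ (by positivity)]
    linarith
  have hle := norm_add_add_norm_sub_le (Λ s) (ε • G) hG
  have hsub : Λ (s - ε • H) = Λ s - Λ (ε • H) := map_sub Λ _ _
  rw [map_smul, ← hΛ, ← map_smul, ← map_add, ← hsub] at hle
  have hp : ν (s + ε • H) = ν s := by rw [map_add, map_smul, hν, smul_zero, add_zero]
  have hm : ν (s - ε • H) = ν s := by rw [map_sub, map_smul, hν, smul_zero, sub_zero]
  have hp' := hs.1.2 (s + ε • H) (hp ▸ hs.1.1)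
  have hm' := hs.1.2 (s - ε • H) (hm ▸ hs.1.1)
  -- Each perturbed norm is at least `‖Λ s‖` while their sum is at most `2‖Λ s‖`, so both are equal
  -- to it.
  have hps : s + ε • H ∈ minimizers Λ ν C :=
    ⟨hp ▸ hs.1.1, fun g hg => le_trans (by linarith) (hs.1.2 g hg)⟩
  have hms : s - ε • H ∈ minimizers Λ ν C :=
    ⟨hm ▸ hs.1.1, fun g hg => le_trans (by linarith) (hs.1.2 g hg)⟩
  have hseg : s ∈ openSegment ℝ (s + ε • H) (s - ε • H) :=
    ⟨1 / 2, 1 / 2, by norm_num, by norm_num, by norm_num, by module⟩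
  have h0 : s + ε • H = s := hs.2 hps hms hseg
  have h1 : H = 0 := (smul_eq_zero.1 (add_eq_left.1 h0)).resolve_left hε.ne'
  change mulMeasure (Λ s) G = 0
  rw [← hΛ, h1, map_zero]

end minimizers

/-! ### Compactness in the extended space -/

/-- Finite measures with the weak* topology, together with the coordinates of a null space. -/
abbrev Extended (d N : ℕ) : Type := WeakDual ℝ C₀(E d, ℝ) × (Fin N → ℝ)

/-- The measure of an element of the extended space. -/
def Extended.measure (d N : ℕ) : Extended d N →ₗ[ℝ] M d :=
  WeakDual.toStrongDual.toLinearMap.comp (LinearMap.fst ℝ _ _)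

theorem locallyConvexSpace_weakDual (F : Type*) [SeminormedAddCommGroup F] [NormedSpace ℝ F] :
    LocallyConvexSpace ℝ (WeakDual ℝ F) :=
  (WeakDual.withSeminorms ℝ F).toLocallyConvexSpace

instance : LocallyConvexSpace ℝ (WeakDual ℝ C₀(E d, ℝ)) :=
  locallyConvexSpace_weakDual C₀(E d, ℝ)

theorem mem_preimage_closedBall_iff {F : Type*} [SeminormedAddCommGroup F] [NormedSpace ℝ F]
    {w : WeakDual ℝ F} {r : ℝ} :
    w ∈ (WeakDual.toStrongDual ⁻¹' Metric.closedBall 0 r : Set (WeakDual ℝ F)) ↔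
      ‖WeakDual.toStrongDual w‖ ≤ r := by
  rw [mem_preimage, mem_closedBall_zero_iff]

section Extended

variable {N m : ℕ} {C : Set (Fin m → ℝ)} (ν : Extended d N →L[ℝ] (Fin m → ℝ))

/-- Banach–Alaoglu handles the measure. An injective linear map in finite dimension is bounded
below, so `c` is controlled by `ν (0, c) = ν (w, c) - ν (w, 0)`, a difference of bounded terms. -/
theorem isCompact_extended_sublevel (hν : ∀ c, ν (0, c) = 0 → c = 0) (hC : IsCompact C) (r : ℝ) :
    IsCompact {z : Extended d N | ‖Extended.measure d N z‖ ≤ r ∧ ν z ∈ C} := by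
  let B : Set (WeakDual ℝ C₀(E d, ℝ)) := WeakDual.toStrongDual ⁻¹' Metric.closedBall 0 r
  have hB : IsCompact B := WeakDual.isCompact_closedBall 0 r
  have hBc : IsClosed B := WeakDual.isClosed_closedBall 0 r
  let νc : (Fin N → ℝ) →ₗ[ℝ] (Fin m → ℝ) := ν.toLinearMap.comp (LinearMap.inr ℝ _ _)
  obtain ⟨κ, -, hκ⟩ := νc.exists_antilipschitzWith (LinearMap.ker_eq_bot'.2 hν)
  have h1 : IsCompact ((fun w => ν (w, 0)) '' B) := hB.image (by fun_prop)
  obtain ⟨r1, hr1⟩ := h1.isBounded.exists_norm_le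
  obtain ⟨r2, hr2⟩ := hC.isBounded.exists_norm_le
  refine (hB.prod (isCompact_closedBall (0 : Fin N → ℝ) (κ * (r2 + r1)))).of_isClosed_subset
    ?_ ?_
  · have hset : {z : Extended d N | ‖Extended.measure d N z‖ ≤ r ∧ ν z ∈ C}
        = Prod.fst ⁻¹' B ∩ ν ⁻¹' C := by
      ext z
      exact and_congr_left fun _ => mem_preimage_closedBall_iff.symm
    rw [hset]
    exact (hBc.preimage continuous_fst).inter (hC.isClosed.preimage ν.continuous)
  · rintro ⟨w, c⟩ ⟨hw, hz⟩
    have hwB : w ∈ B := mem_preimage_closedBall_iff.2 hw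
    refine ⟨hwB, ?_⟩
    have h2 : ‖c‖ ≤ κ * ‖νc c‖ := by
      simpa using hκ.le_mul_dist c 0
    have h3 : νc c = ν (w, c) - ν (w, 0) := by
      rw [← map_sub]; simp [νc]
    rw [mem_closedBall_zero_iff]
    refine h2.trans (mul_le_mul_of_nonneg_left ?_ κ.2)
    rw [h3]
    exact (norm_sub_le _ _).trans (add_le_add (hr2 _ hz) (hr1 _ (mem_image_of_mem _ hwB)))

/-- The dual norm is weak* lower semicontinuous, its closed balls being weak* closed. It is
minimized on the sublevel of a feasible point, and the set of minimizers is again a compact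
sublevel. -/
theorem extended_minimizers_nonempty_and_isCompact (hν : ∀ c, ν (0, c) = 0 → c = 0)
    (hC : IsCompact C) (hf : ∃ z, ν z ∈ C) :
    (minimizers (X := Extended d N) (Extended.measure d N) ν.toLinearMap C).Nonempty ∧
      IsCompact (minimizers (X := Extended d N) (Extended.measure d N) ν.toLinearMap C) := by
  obtain ⟨z1, hz1⟩ := hf
  have hlsc : LowerSemicontinuous fun z : Extended d N => ‖Extended.measure d N z‖ := by
    rw [lowerSemicontinuous_iff_isClosed_preimage]
    intro r
    have hset : (fun z : Extended d N => ‖Extended.measure d N z‖) ⁻¹' Iic r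
        = Prod.fst ⁻¹' (WeakDual.toStrongDual ⁻¹' Metric.closedBall 0 r) := by
      ext z
      exact mem_preimage_closedBall_iff.symm
    rw [hset]
    exact (WeakDual.isClosed_closedBall 0 r).preimage continuous_fst
  obtain ⟨z0, hz0, hmin⟩ := LowerSemicontinuousOn.exists_isMinOn
    (s := {z | ‖Extended.measure d N z‖ ≤ ‖Extended.measure d N z1‖ ∧ ν z ∈ C})
    ⟨z1, le_rfl, hz1⟩ (isCompact_extended_sublevel ν hν hC _) (hlsc.lowerSemicontinuousOn _)
  have hz0m : z0 ∈ minimizers (X := Extended d N) (Extended.measure d N) ν.toLinearMap C := by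
    refine ⟨hz0.2, fun g hg => ?_⟩
    rcases le_total ‖Extended.measure d N g‖ ‖Extended.measure d N z1‖ with h | h
    · exact hmin ⟨h, hg⟩
    · exact hz0.1.trans h
  refine ⟨⟨z0, hz0m⟩, ?_⟩
  convert isCompact_extended_sublevel ν hν hC ‖Extended.measure d N z0‖ using 1
  ext z
  exact ⟨fun h => ⟨h.2 z0 hz0m.1, h.1⟩, fun h => ⟨h.2, fun g hg => h.1.trans (hz0m.2 g hg)⟩⟩

end Extended

/-! ### The native space inside the extended space -/

namespace Operator

variable {n N m : ℕ} {L : Operator d n} {ρ : Fun d}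
  {φ : Fin N → Module.Dual ℝ L.nativeSpace} {p : Module.Basis (Fin N) ℝ L.nullSpace}

/-- The embedding `f ↦ (L f, φ(f))` of the native space. -/
def embed (L : Operator d n) (φ : Fin N → Module.Dual ℝ L.nativeSpace) :
    L.nativeSpace →ₗ[ℝ] Extended d N :=
  (StrongDual.toWeakDual.toLinearMap.comp L.toFun).prod (LinearMap.pi φ)

theorem Biorthogonal.apply_sum (h : L.Biorthogonal φ p) (c : Fin N → ℝ) (k : Fin N) :
    φ k ((∑ j, c j • p j : L.nullSpace) : L.nativeSpace) = c k := by
  simp [h k]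

theorem Biorthogonal.embed_injective (h : L.Biorthogonal φ p) :
    Function.Injective (L.embed φ) := by
  refine (injective_iff_map_eq_zero (L.embed φ)).2 fun f hf => ?_
  have h1 : L.toFun f = 0 := congrArg (Extended.measure d N) hf
  have h2 : ∀ k, φ k f = 0 := fun k => congrFun (congrArg Prod.snd hf) k
  have h3 := p.sum_repr ⟨f, h1⟩
  have h4 : ∀ k, p.repr ⟨f, h1⟩ k = 0 := fun k => by
    rw [← h.apply_sum (fun j => p.repr ⟨f, h1⟩ j) k, h3]
    exact h2 k
  simp only [h4, zero_smul, Finset.sum_const_zero] at h3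
  exact (congrArg Subtype.val h3).symm

/-- Adding a null-space element adjusts the coordinates at will, so only the measure decides
membership in the range of `embed`. -/
theorem Biorthogonal.exists_embed_eq (h : L.Biorthogonal φ p) (f : L.nativeSpace)
    (z : Extended d N) (hz : Extended.measure d N z = L.toFun f) : ∃ f', L.embed φ f' = z := by
  let q : L.nullSpace := ∑ j, (z.2 j - φ j f) • p j
  refine ⟨f + q, Prod.ext ?_ (funext fun k => ?_)⟩
  · have hq : L.toFun q = 0 := q.2
    have : L.toFun (f + q) = Extended.measure d N z := by rw [map_add, hq, add_zero, hz]
    exact this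
  · have : φ k (f + q) = z.2 k := by
      rw [map_add, h.apply_sum]; ring
    exact this

theorem exists_of_mem_predual {ℓ : Module.Dual ℝ L.nativeSpace} (hℓ : ℓ ∈ L.predual φ) :
    ∃ ℓ' : Extended d N →L[ℝ] ℝ, ∀ f, ℓ f = ℓ' (L.embed φ f) := by
  induction hℓ using Submodule.span_induction with
  | mem ℓ hℓ =>
    rcases hℓ with ⟨h, hh⟩ | ⟨k, rfl⟩
    · let ev : WeakDual ℝ C₀(E d, ℝ) →L[ℝ] ℝ := WeakBilin.eval (topDualPairing ℝ C₀(E d, ℝ)) h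
      exact ⟨ev.comp (ContinuousLinearMap.fst ℝ _ _), hh⟩
    · exact ⟨(ContinuousLinearMap.proj k).comp (ContinuousLinearMap.snd ℝ _ _), fun _ => rfl⟩
  | zero => exact ⟨0, fun _ => rfl⟩
  | add u v _ _ hu hv =>
    obtain ⟨u', hu⟩ := hu
    obtain ⟨v', hv⟩ := hv
    exact ⟨u' + v', fun f => by simp [hu, hv]⟩
  | smul c u _ hu =>
    obtain ⟨u', hu⟩ := hu
    exact ⟨c • u', fun f => by simp [hu]⟩

theorem weakStar_eq_induced_embed (L : Operator d n) (φ : Fin N → Module.Dual ℝ L.nativeSpace) :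
    L.weakStar φ = TopologicalSpace.induced (L.embed φ) inferInstance := by
  have hev : ∀ ℓ ∈ L.predual φ, @Continuous _ _ (L.weakStar φ) _ ℓ := fun ℓ hℓ => by
    let _ := L.weakStar φ
    have h1 : Continuous fun f (ℓ : L.predual φ) => (ℓ : Module.Dual ℝ L.nativeSpace) f :=
      continuous_induced_dom
    exact (continuous_apply (⟨ℓ, hℓ⟩ : L.predual φ)).comp h1
  apply le_antisymm
  · rw [← continuous_iff_le_induced]
    let _ := L.weakStar φ
    refine Continuous.prodMk ?_ (continuous_pi fun k => ?_)
    · refine WeakDual.continuous_of_continuous_eval fun h => ?_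
      exact hev ((ContinuousLinearMap.apply ℝ ℝ h).toLinearMap.comp L.toFun)
        (Submodule.subset_span (Or.inl ⟨h, fun _ => rfl⟩))
    · exact hev (φ k) (Submodule.subset_span (Or.inr ⟨k, rfl⟩))
  · let _ : TopologicalSpace L.nativeSpace :=
      TopologicalSpace.induced (L.embed φ) inferInstance
    refine continuous_iff_le_induced.1 (?_ : Continuous fun f (ℓ : L.predual φ) =>
      (ℓ : Module.Dual ℝ L.nativeSpace) f)
    refine continuous_pi fun ℓ => ?_
    obtain ⟨ℓ', h⟩ := exists_of_mem_predual ℓ.2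
    simp only [h]
    exact ℓ'.continuous.comp continuous_induced_dom

/-- A weak*-continuous linear map factors through the embedding of the native space. -/
theorem exists_extension_of_continuous_weakStar (ν : L.nativeSpace →ₗ[ℝ] (Fin m → ℝ))
    (hν : @Continuous _ _ (L.weakStar φ) _ ν) :
    ∃ ν' : Extended d N →L[ℝ] (Fin m → ℝ), ∀ f, ν f = ν' (L.embed φ f) := by
  have h : ∀ i, (LinearMap.proj i).comp ν ∈ L.predual φ := by
    intro i
    -- A functional continuous for the topology induced by a family of functionals lies in the span
    -- of that family, and the predual is its own span.
    have h1 : (LinearMap.proj i).comp ν ∈ Submodule.span ℝ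
        (range fun ℓ : L.predual φ => (ℓ : Module.Dual ℝ L.nativeSpace)) := by
      rw [LinearMap.mem_span_iff_continuous, ← induced_to_pi]
      let _ := L.weakStar φ
      exact (continuous_apply i).comp hν
    simpa using h1
  choose ν' hν' using fun i => exists_of_mem_predual (h i)
  exact ⟨ContinuousLinearMap.pi ν', fun f => funext fun i => hν' i f⟩

theorem coeFn_sum_smul {ι : Type*} (s : Finset ι) (c : ι → ℝ) (F : ι → Fun d) :
    (∑ i ∈ s, c i • F i : Fun d) =ᵐ[volume] fun t => ∑ i ∈ s, c i * F i t := by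
  classical
  induction s using Finset.induction_on with
  | empty =>
    simp only [Finset.sum_empty]
    exact AEEqFun.coeFn_zero
  | insert i s hi ih =>
    rw [Finset.sum_insert hi]
    filter_upwards [ih, AEEqFun.coeFn_add (c i • F i) (∑ i ∈ s, c i • F i),
      AEEqFun.coeFn_smul (c i) (F i)] with t h1 h2 h3
    rw [h2, Pi.add_apply, h1, h3, Finset.sum_insert hi]
    rfl

/-- A function whose image under `L` is a combination of Dirac impulses is a spline. -/
theorem SplineAdmissible.exists_spline_coefficients (hL : L.SplineAdmissible ρ)
    (p : Module.Basis (Fin N) ℝ L.nullSpace) {K : ℕ} (a : Fin K → ℝ) (x : Fin K → E d)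
    (s : L.nativeSpace) (hs : L.toFun s = ∑ k, a k • dirac (x k)) :
    ∃ b : Fin N → ℝ, ∀ᵐ t : E d, (s : Fun d) t =
      ∑ k, a k * ρ (t - x k) + ∑ j, b j * ((p j : L.nativeSpace) : Fun d) t := by
  choose hmem hdir using hL.exists_shift_green
  -- The spline `u` has the same image under `L` as `s`, so `s - u` expands in the basis of the null
  -- space.
  let u : L.nativeSpace := ∑ k, a k • ⟨shift (x k) ρ, hmem (x k)⟩
  have hu : L.toFun u = L.toFun s := by
    simp only [u, map_sum, map_smul, hdir, hs]
  let q : L.nullSpace := ⟨s - u, by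
    change L.toFun (s - u) = 0
    rw [map_sub, hu, sub_self]⟩
  refine ⟨fun j => p.repr q j, ?_⟩
  have hsum : (s : Fun d) = ∑ k, a k • shift (x k) ρ
      + ∑ j, p.repr q j • ((p j : L.nativeSpace) : Fun d) := by
    have h1 : (s : Fun d) = (u : Fun d) + ((q : L.nativeSpace) : Fun d) := by simp [q]
    have h2 : ((q : L.nativeSpace) : Fun d)
        = ∑ j, p.repr q j • ((p j : L.nativeSpace) : Fun d) := by
      conv_lhs => rw [← p.sum_repr q]
      simp only [Submodule.coe_sum, Submodule.coe_smul]
    rw [h1, ← h2]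
    simp [u]
  have hshift : ∀ᵐ t : E d, ∀ k, (shift (x k) ρ) t = ρ (t - x k) :=
    ae_all_iff.2 fun k => coeFn_shift (x k) ρ
  rw [hsum]
  filter_upwards [hshift, AEEqFun.coeFn_add (∑ k, a k • shift (x k) ρ)
      (∑ j, p.repr q j • ((p j : L.nativeSpace) : Fun d)),
    coeFn_sum_smul Finset.univ a fun k => shift (x k) ρ,
    coeFn_sum_smul Finset.univ (fun j => p.repr q j) fun j => ((p j : L.nativeSpace) : Fun d)]
    with t h1 h2 h3 h4
  rw [h2, Pi.add_apply, h3, h4]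
  simp only [h1]

end Operator

end GTV

end

/-! ### Transfer to the native space -/

theorem theorem1 {d n₀ N₀ m : ℕ} (L : GTV.Operator d n₀) (ρ : GTV.Fun d)
    (hL : L.SplineAdmissible ρ)
    (φ : Fin N₀ → Module.Dual ℝ L.nativeSpace) (p : Module.Basis (Fin N₀) ℝ L.nullSpace)
    (hφp : L.Biorthogonal φ p)
    (ν : L.nativeSpace →ₗ[ℝ] (Fin m → ℝ))
    (hν : @Continuous _ _ (L.weakStar φ) _ ν)
    (hν_inj : ∀ q₁ ∈ L.nullSpace, ∀ q₂ ∈ L.nullSpace, ν q₁ = ν q₂ ↔ q₁ = q₂)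
    (C : Set (Fin m → ℝ)) (hC_convex : Convex ℝ C) (hC_compact : IsCompact C)
    (hC_feasible : ∃ f : L.nativeSpace, ν f ∈ C) :
    ∃ β : ℝ,
      IsLeast ((fun f : L.nativeSpace => ‖L.toFun f‖) '' {f | ν f ∈ C}) β ∧
      (∀ s ∈ (L.solutions ν C).extremePoints ℝ,
        ∃ K : ℕ, K ≤ m ∧ ∃ (a : Fin K → ℝ) (x : Fin K → GTV.E d) (b : Fin N₀ → ℝ),
          Function.Injective x ∧
          (∀ᵐ t : GTV.E d, (s : GTV.Fun d) t =
            ∑ k, a k * ρ (t - x k) + ∑ n, b n * ((p n : L.nativeSpace) : GTV.Fun d) t) ∧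
          L.toFun s = ∑ k, a k • GTV.dirac (x k) ∧
          β = ‖L.toFun s‖ ∧ ‖L.toFun s‖ = ∑ k, |a k|) ∧
      L.solutions ν C =
        @closure _ (L.weakStar φ) (convexHull ℝ ((L.solutions ν C).extremePoints ℝ)) := by
  open GTV in
  obtain ⟨ν', hν'⟩ := Operator.exists_extension_of_continuous_weakStar ν hν
  have hinj' : ∀ c, ν' (0, c) = 0 → c = 0 := by
    intro c hc
    obtain ⟨q, hq⟩ := hφp.exists_embed_eq 0 (0, c) (map_zero L.toFun).symm
    have hq0 : L.toFun q = 0 := congrArg (Extended.measure d N₀) hq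
    have h1 : q = 0 := (hν_inj q hq0 0 (Submodule.zero_mem _)).1 (by rw [hν', hq, hc, map_zero])
    rw [h1, map_zero] at hq
    exact (congrArg Prod.snd hq).symm
  obtain ⟨hne, hcpt⟩ := extended_minimizers_nonempty_and_isCompact ν' hinj' hC_compact
    (hC_feasible.imp' (L.embed φ) fun f hf => hν' f ▸ hf)
  set S := minimizers (X := Extended d N₀) (Extended.measure d N₀) ν'.toLinearMap C with hS
  have hSc : Convex ℝ S := convex_minimizers hC_convex
  -- In the extended space every product `g w` is attained, so extreme points are Dirac
  -- combinations, lifted by shifted Green's functions.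
  have hext : ∀ z ∈ S.extremePoints ℝ, ∃ f, L.embed φ f = z := by
    intro z hz
    obtain ⟨K, -, a, x, -, hz'⟩ := exists_eq_sum_dirac_of_mem_extremePoints (fun z g _ =>
      ⟨(StrongDual.toWeakDual (mulMeasure (Extended.measure d N₀ z) g), 0), rfl⟩) hz
    choose hmem hdir using hL.exists_shift_green
    refine hφp.exists_embed_eq (∑ k, a k • ⟨shift (x k) ρ, hmem (x k)⟩) z ?_
    simp only [hz', map_sum, map_smul, hdir]
  obtain ⟨z₀, hz₀⟩ := hcpt.extremePoints_nonempty hne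
  obtain ⟨f₀, rfl⟩ := hext z₀ hz₀
  -- The point `f₀` attains the extended minimum within the native space, so the two minimal values
  -- agree.
  have hsol : ∀ f, f ∈ L.solutions ν C ↔ L.embed φ f ∈ S := by
    intro f
    constructor
    · intro hf
      refine ⟨hν' f ▸ hf.1, fun z hz => ?_⟩
      exact (hf.2 f₀ ((hν' f₀).symm ▸ hz₀.1.1)).trans (hz₀.1.2 z hz)
    · intro hf
      exact ⟨(hν' f).symm ▸ hf.1, fun g hg => hf.2 (L.embed φ g) (hν' g ▸ hg)⟩
  have hf₀ := (hsol f₀).2 hz₀.1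
  refine ⟨‖L.toFun f₀‖, ⟨⟨f₀, hf₀.1, rfl⟩, ?_⟩, ?_, ?_⟩
  · rintro _ ⟨g, hg, rfl⟩
    exact hf₀.2 g hg
  · intro s hs
    obtain ⟨K, hK, a, x, hx, hsx⟩ := exists_eq_sum_dirac_of_mem_extremePoints
      (fun f g hg => hL.exists_toFun_eq_mulMeasure (L.toFun f) g hg) hs
    obtain ⟨b, hb⟩ := hL.exists_spline_coefficients p a x s hsx
    refine ⟨K, hK, a, x, b, hx, hb, hsx, ?_, ?_⟩
    · exact le_antisymm (hf₀.2 s hs.1.1) (hs.1.2 f₀ hf₀.1)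
    · rw [hsx, norm_sum_dirac hx]
  · have hpre : L.solutions ν C = L.embed φ ⁻¹' S := Set.ext hsol
    rw [Operator.weakStar_eq_induced_embed]
    let _ : TopologicalSpace L.nativeSpace :=
      TopologicalSpace.induced (L.embed φ) inferInstance
    have hind : Topology.IsInducing (L.embed φ) := ⟨rfl⟩
    apply Subset.antisymm
    · intro f hf
      rw [hind.closure_eq_preimage_closure_image, mem_preimage]
      have h1 : L.embed φ f ∈ closure (convexHull ℝ (S.extremePoints ℝ)) := by
        rw [closure_convexHull_extremePoints hcpt hSc]
        exact (hsol f).1 hf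
      refine closure_mono ?_ h1
      rw [LinearMap.image_convexHull]
      refine convexHull_mono fun z hz => ?_
      obtain ⟨g, rfl⟩ := hext z hz
      -- Linearity and injectivity of `embed` pull extremality back.
      refine mem_image_of_mem _ ⟨(hsol g).2 hz.1, fun u hu v hv huv => ?_⟩
      refine hφp.embed_injective (hz.2 ((hsol u).1 hu) ((hsol v).1 hv) ?_)
      obtain ⟨r, t, hr, ht, hrt, rfl⟩ := huv
      exact ⟨r, t, hr, ht, hrt, by simp⟩
    · refine closure_minimal (convexHull_min extremePoints_subset ?_) ?_
      · exact convex_minimizers hC_convex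
      · rw [hpre]
        exact hcpt.isClosed.preimage hind.continuous
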